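/- Let $n\ge 1$, $T>0$, let $D\subseteq\mathbf R^n$ be a non-empty open set which is either $\mathbf R^n$ or bounded with $C^2$-smooth boundary, and put $Q=D\times(0,T)$. Write $H^0=L_2(D)$, with $(U,V)_{H^0}=\sum_i (U_i,V_i)_{L_2(D)}$ for vector functions; let $H^1$ be the closure in $W_2^1(D)$ of the smooth functions in $W^1_2(D)$ that vanish on $\partial D$, let $H^{-1}$ be the dual of $H^1$, and let $X^0=L^2([0,T];H^0)$ and $Y^1=L^2([0,T];H^1)\cap C([0,T];H^0)$. Let $$\mathcal A y=\nabla\cdot(b\nabla y)+f\cdot\nabla y+\lambda y,$$ where $b=b^\top:Q\to\mathbf R^{n\times n}$, $f:Q\to\mathbf R^n$, $\lambda:Q\to\mathbf R$ are measurable, $\xi^\top b(x,t)\xi\ge\delta|\xi|^2$ for all $\xi\in\mathbf R^n$, $(x,t)\in Q$, with a constant $\delta>0$, and $\operatorname{ess\,sup}_Q(|b|+|b^{-1}|+|f|+|\lambda|)<\infty$ ($|b|$ being the Frobenius norm). Denote by $\mu=(T,n,D,\delta,b,f,\lambda)$ the collection of all these parameters and put $$\mathcal P(\mu)=\Bigl(T,n,D,\delta,\operatorname{ess\,sup}_Q(|b|+|f|+|\lambda|)\Bigr).$$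 For $F=(F_1,\dots,F_n)$ and $F_0$ with $F_k\in X^0$, $k=0,\dots,n$, let $u\in Y^1$ be the weak solution of $$\frac{\partial u}{\partial t}=\mathcal A u+\nabla\cdot F+F_0,\qquad u(x,0)=0,\qquad u(x,t)|_{x\in\partial D}=0 .$$ For $K,M\in\mathbf R$ and a value $\mathcal P$ of $\mathcal P(\cdot)$, call a pair $(\tilde C_1,\tilde C_0)$ of positive numbers suitable for $(K,M,\mathcal P)$ if, for every $\mu$ with $\mathcal P(\mu)=\mathcal P$, all $F,F_0$ as above and the corresponding solution $u$, and all $t\in(0,T)$, $$e^{-2Kt}\|u(\cdot,t)\|^2_{H^0}+M\int_0^t e^{-2Ks}\|u(\cdot,s)\|^2_{H^0}ds\le \tilde C_1\int_0^t e^{-2Ks}\bigl(F(\cdot,s),b(\cdot,s)^{-1}F(\cdot,s)\bigr)_{H^0}ds+\tilde C_0\int_0^t e^{-2Ks}\|F_0(\cdot,s)\|^2_{H^0}ds .$$ For $i=0,1$ let $C_i(K,M,\mathcal P)\in[0,\infty]$ be the infimum of $\tilde C_i$ over all suitable pairs $(\tilde C_1,\tilde C_0)$ (with $\inf\emptyset=\infty$).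 Then $$\sup_{\mu,\,M\ge0}\ \inf_{K\ge0} C_1(K,M,\mathcal P(\mu))\le\frac12,\qquad \sup_{\mu,\,M\ge0}\ \inf_{K\ge0} C_0(K,M,\mathcal P(\mu))=0,$$ the suprema being over all admissible $\mu$ (all $n$, $D$, $T$, $\delta$, $b$, $f$, $\lambda$) and all $M\ge0$. Moreover, both constants can be achieved simultaneously: for every $\mu$, $M\ge0$ and $\varepsilon>0$ there is $K_0\ge0$, depending only on $\varepsilon$, $M$ and $\mathcal P(\mu)$, such that the pair $\bigl(\tfrac12+\varepsilon,\varepsilon\bigr)$ is suitable for $(K,M,\mathcal P(\mu))$ for all $K\ge K_0$. -/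

import Mathlib

open MeasureTheory Set Filter Topology
open scoped ENNReal ContDiff Matrix

namespace Parabolic

noncomputable section

/-- The Euclidean space `ℝⁿ`. -/
abbrev Rn (n : ℕ) : Type := EuclideanSpace ℝ (Fin n)

/-! ### Domains -/

/-- `D` has a `C²`-smooth boundary: near each boundary point, `D` is the set where a `C²` function
with non-vanishing differential is negative. -/
def HasC2Boundary {n : ℕ} (D : Set (Rn n)) : Prop :=
  ∀ x₀ ∈ frontier D, ∃ U : Set (Rn n), IsOpen U ∧ x₀ ∈ U ∧
    ∃ ψ : Rn n → ℝ, ContDiffOn ℝ 2 ψ U ∧ (∀ x ∈ U, fderiv ℝ ψ x ≠ 0) ∧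
      D ∩ U = {x | x ∈ U ∧ ψ x < 0}

/-- The domains under consideration: `D` is a non-empty open set which is either the whole space or
bounded with a `C²`-smooth boundary. -/
structure IsAdmissibleDomain {n : ℕ} (D : Set (Rn n)) : Prop where
  isOpen : IsOpen D
  nonempty : D.Nonempty
  whole_or_bounded : D = univ ∨ (Bornology.IsBounded D ∧ HasC2Boundary D)

/-- The cylinder `Q = D × (0,T)`. -/
def cylinder {n : ℕ} (D : Set (Rn n)) (T : ℝ) : Set (Rn n × ℝ) := D ×ˢ Ioo 0 T

/-! ### Sobolev spaces -/

/-- `v ∈ W₂¹(D)` with distributional gradient `g`. -/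
structure MemW12 {n : ℕ} (D : Set (Rn n)) (v : Rn n → ℝ) (g : Rn n → Rn n) : Prop where
  memLp : MemLp v 2 (volume.restrict D)
  memLp_grad : MemLp g 2 (volume.restrict D)
  weak_grad : ∀ η : Rn n → ℝ, ContDiff ℝ ∞ η → HasCompactSupport η → tsupport η ⊆ D →
    ∀ i : Fin n, ∫ x in D, v x * gradient η x i = - ∫ x in D, g x i * η x

/-- `φ` is smooth in `D`, vanishes (continuously) on the boundary of `D`, and has a finite
`W₂¹(D)`-norm. -/
structure IsSmoothVanishing {n : ℕ} (D : Set (Rn n)) (φ : Rn n → ℝ) : Prop where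
  smooth : ContDiffOn ℝ ∞ φ D
  continuousOn : ContinuousOn φ (closure D)
  boundary : ∀ x ∈ frontier D, φ x = 0
  memLp : MemLp φ 2 (volume.restrict D)
  memLp_grad : MemLp (gradient φ) 2 (volume.restrict D)

/-- `v ∈ H¹`, with distributional gradient `g`. Here `H¹` is the closure, in the `W₂¹(D)`-norm, of
the smooth functions which vanish on the boundary of `D`. -/
structure MemH1 {n : ℕ} (D : Set (Rn n)) (v : Rn n → ℝ) (g : Rn n → Rn n) : Prop where
  memW12 : MemW12 D v g
  approx : ∀ ε : ℝ≥0∞, 0 < ε → ∃ φ : Rn n → ℝ, IsSmoothVanishing D φ ∧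
    eLpNorm (fun x => v x - φ x) 2 (volume.restrict D) < ε ∧
    eLpNorm (fun x => g x - gradient φ x) 2 (volume.restrict D) < ε

/-- `u ∈ X¹ = L²([0,T]; H¹)`, with spatial gradient `G`. -/
structure MemX1 {n : ℕ} (D : Set (Rn n)) (T : ℝ) (u : Rn n × ℝ → ℝ) (G : Rn n × ℝ → Rn n) :
    Prop where
  memLp : MemLp u 2 (volume.restrict (cylinder D T))
  memLp_grad : MemLp G 2 (volume.restrict (cylinder D T))
  slice : ∀ᵐ t ∂(volume.restrict (Ioo 0 T)), MemH1 D (fun x => u (x, t)) (fun x => G (x, t))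

/-- `u ∈ C⁰ = C([0,T]; L₂(D))`. -/
structure MemC0 {n : ℕ} (D : Set (Rn n)) (T : ℝ) (u : Rn n × ℝ → ℝ) : Prop where
  memLp : ∀ t ∈ Icc 0 T, MemLp (fun x => u (x, t)) 2 (volume.restrict D)
  continuous : ∀ t ∈ Icc 0 T,
    Tendsto (fun s => eLpNorm (fun x => u (x, s) - u (x, t)) 2 (volume.restrict D))
      (𝓝[Icc 0 T] t) (𝓝 0)

/-! ### The parameters of the problem -/

/-- The Frobenius norm of a matrix. -/
def frobenius {n : ℕ} (A : Matrix (Fin n) (Fin n) ℝ) : ℝ := √(∑ i, ∑ j, A i j ^ 2)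

/-- A full set of admissible parameters `μ = (T, n, D, δ, b, f, λ)`. -/
structure Parameters where
  T : ℝ
  T_pos : 0 < T
  n : ℕ
  n_pos : 0 < n
  D : Set (Rn n)
  domain : IsAdmissibleDomain D
  δ : ℝ
  δ_pos : 0 < δ
  b : Rn n × ℝ → Matrix (Fin n) (Fin n) ℝ
  f : Rn n × ℝ → Rn n
  lam : Rn n × ℝ → ℝ
  b_meas : ∀ i j, AEMeasurable (fun p => b p i j) (volume.restrict (cylinder D T))
  f_meas : AEMeasurable f (volume.restrict (cylinder D T))
  lam_meas : AEMeasurable lam (volume.restrict (cylinder D T))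
  b_symm : ∀ p ∈ cylinder D T, (b p).IsSymm
  coercive : ∀ p ∈ cylinder D T, ∀ ξ : Rn n, δ * ‖ξ‖ ^ 2 ≤ ξ.ofLp ⬝ᵥ (b p *ᵥ ξ.ofLp)
  bounded : essSup
    (fun p => ENNReal.ofReal (frobenius (b p) + frobenius (b p)⁻¹ + ‖f p‖ + |lam p|))
    (volume.restrict (cylinder D T)) < ⊤

/-- The reduced tuple `P = (T, n, D, δ, Λ)` on which the constants are allowed to depend. -/
structure ReducedParameters where
  T : ℝ
  n : ℕ
  D : Set (Rn n)
  δ : ℝ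
  bound : ℝ≥0∞

/-- `P(μ) = (T, n, D, δ, ess sup_Q (|b| + |f| + |λ|))`. -/
def Parameters.reduced (μ : Parameters) : ReducedParameters where
  T := μ.T
  n := μ.n
  D := μ.D
  δ := μ.δ
  bound := essSup (fun p => ENNReal.ofReal (frobenius (μ.b p) + ‖μ.f p‖ + |μ.lam p|))
    (volume.restrict (cylinder μ.D μ.T))

/-! ### Solutions of the boundary value problem -/

/-- `u ∈ Y¹ = X¹ ∩ C⁰` is the solution of `∂u/∂t = ∇·(b∇u) + f·∇u + λu + ∇·F + F₀` in `D × (0,T)`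
with `u(·,0) = 0` and `u = 0` on `∂D`; the equation, integrated in time, holds in `H⁻¹`, the dual
space of `H¹`. -/
def IsSolution (μ : Parameters) (F : Rn μ.n × ℝ → Rn μ.n) (F₀ : Rn μ.n × ℝ → ℝ)
    (u : Rn μ.n × ℝ → ℝ) : Prop :=
  MemC0 μ.D μ.T u ∧
  (∀ᵐ x ∂(volume.restrict μ.D), u (x, 0) = 0) ∧
  ∃ G : Rn μ.n × ℝ → Rn μ.n, MemX1 μ.D μ.T u G ∧
    ∀ (w : Rn μ.n → ℝ) (g : Rn μ.n → Rn μ.n), MemH1 μ.D w g → ∀ t ∈ Icc 0 μ.T,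
      ∫ x in μ.D, u (x, t) * w x =
        ∫ s in (0 : ℝ)..t, ∫ x in μ.D,
          (- (∑ i, ((∑ j, μ.b (x, s) i j * G (x, s) j) + F (x, s) i) * g x i)
            + ((∑ i, μ.f (x, s) i * G (x, s) i) + μ.lam (x, s) * u (x, s) + F₀ (x, s)) * w x)

/-! ### The energy estimate and its best constants -/

/-- The constants `c₁, c₀ > 0` are suitable for the energy estimate with given `K`, `M`, for all
problems with the given reduced parameters `P`, all `φ = ∇·F + F₀`, and all `t ∈ (0,T)`. -/
def EnergyEstimate (K M : ℝ) (P : ReducedParameters) (c₁ c₀ : ℝ) : Prop :=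
  0 < c₁ ∧ 0 < c₀ ∧
  ∀ μ : Parameters, μ.reduced = P →
  ∀ (F : Rn μ.n × ℝ → Rn μ.n) (F₀ u : Rn μ.n × ℝ → ℝ),
    MemLp F 2 (volume.restrict (cylinder μ.D μ.T)) →
    MemLp F₀ 2 (volume.restrict (cylinder μ.D μ.T)) →
    IsSolution μ F F₀ u →
    ∀ t ∈ Ioo 0 μ.T,
      Real.exp (-2 * K * t) * (∫ x in μ.D, u (x, t) ^ 2)
        + M * ∫ s in (0 : ℝ)..t, Real.exp (-2 * K * s) * ∫ x in μ.D, u (x, s) ^ 2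
      ≤ c₁ * (∫ s in (0 : ℝ)..t, Real.exp (-2 * K * s) *
            ∫ x in μ.D, (F (x, s)).ofLp ⬝ᵥ ((μ.b (x, s))⁻¹ *ᵥ (F (x, s)).ofLp))
        + c₀ * ∫ s in (0 : ℝ)..t, Real.exp (-2 * K * s) * ∫ x in μ.D, F₀ (x, s) ^ 2

/-- The best first constant `C₁(K, M, P)` (with the value `∞` if there is no suitable one). -/
def C₁ (K M : ℝ) (P : ReducedParameters) : ℝ≥0∞ :=
  ⨅ (c₁ : ℝ) (c₀ : ℝ) (_ : EnergyEstimate K M P c₁ c₀), ENNReal.ofReal c₁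

/-- The best second constant `C₀(K, M, P)` (with the value `∞` if there is no suitable one). -/
def C₀ (K M : ℝ) (P : ReducedParameters) : ℝ≥0∞ :=
  ⨅ (c₁ : ℝ) (c₀ : ℝ) (_ : EnergyEstimate K M P c₁ c₀), ENNReal.ofReal c₀

/-- `sup_{μ, M ≥ 0} inf_{K ≥ 0} C(K, M, P(μ))`. -/
def supInf (C : ℝ → ℝ → ReducedParameters → ℝ≥0∞) : ℝ≥0∞ :=
  ⨆ (μ : Parameters) (M : ℝ) (_ : 0 ≤ M), ⨅ (K : ℝ) (_ : 0 ≤ K), C K M μ.reduced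

end

end Parabolic

open scoped RealInnerProductSpace

/-! Everything rests on the identity ‖u(t)‖² = 2∫₀ᵗ∫⟪A, V⟫, where V = (∇u, u) and A is the
right-hand side of the equation read as a functional on pairs (gradient, value). No time derivative
of u is needed: for almost every s both u(·,s) and u(·,s+h) are admissible test functions, and
testing the increment u(s+h) − u(s) with their sum gives ‖u(s+h)‖² − ‖u(s)‖². After integrating over
s in (0,t) and dividing by h, the left side tends to ‖u(t)‖² − ‖u(0)‖² because the energy is
continuous, and the right side tends to 2∫∫⟪A, V⟫ because translations are continuous in L²
(`continuous_integral_inner_time_shift`, `energy_identity`).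

The rest is algebra. The weight exp(−2Kt) adds −2K u² to the integrand (`exp_mul_integral_eq`).
Young's inequality with weight 1/2 + ε (`young_form`) bounds −2∇u·F at a cost strictly below the
available 2∇u·b∇u; what is left of the diffusion term is coercive and absorbs the drift. The term
F₀u costs ε F₀² and a multiple of u². All multiples of u² fit under 2K − M once K exceeds
`weightThreshold`, which depends only on M, ε, δ and the coefficient bound (`ae_two_inner_flux_le`).
At weight exactly 1/2 the field F would use up the whole diffusion term, hence the ε. -/

namespace Parabolic

/-! ### Energy identity from symmetric time increments -/

/-- Translation in time preserves the product measure. -/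
theorem measurePreserving_time_shift {X : Type*} [MeasurableSpace X] {m : Measure X} [SFinite m]
    (c : ℝ) :
    MeasurePreserving (fun p : X × ℝ => (p.1, p.2 + c)) (m.prod volume) (m.prod volume) :=
  (MeasurePreserving.id m).prod (measurePreserving_add_right volume c)

/-- The pointwise inner product of two square integrable functions is integrable. -/
theorem integrable_inner_of_memLp {H : Type*} [NormedAddCommGroup H]
    [InnerProductSpace ℝ H] {α : Type*} {mα : MeasurableSpace α} {ν : Measure α}
    {f g : α → H} (hf : MemLp f 2 ν) (hg : MemLp g 2 ν) :
    Integrable (fun a => ⟪f a, g a⟫) ν := by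
  refine (L2.integrable_inner (𝕜 := ℝ) (hf.toLp f) (hg.toLp g)).congr ?_
  filter_upwards [hf.coeFn_toLp, hg.coeFn_toLp] with a h1 h2
  rw [h1, h2]

/-- Averaging over the shift commutes with integration over a space-time cylinder. -/
theorem integral_integral_inner_time_shift {X : Type*} [MeasurableSpace X] {m : Measure X}
    [SFinite m]
    {H : Type*} [NormedAddCommGroup H] [InnerProductSpace ℝ H] {A V : X × ℝ → H}
    (hA : MemLp A 2 (m.prod volume)) (hV : MemLp V 2 (m.prod volume)) (D : Set X)
    {t : ℝ} (ht : 0 ≤ t) (h : ℝ) :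
    h * ∫ θ in (0 : ℝ)..1, ∫ p in D ×ˢ Ioc 0 t, ⟪A (p.1, p.2 + h * θ), V p + V (p.1, p.2 + h)⟫
        ∂(m.prod volume)
      = ∫ s in (0 : ℝ)..t, ∫ r in s..s + h, ∫ x in D, ⟪A (x, r), V (x, s) + V (x, s + h)⟫ ∂m := by
  have hVs : MemLp (fun p : X × ℝ => V p + V (p.1, p.2 + h)) 2 (m.prod volume) :=
    hV.add (hV.comp_measurePreserving (measurePreserving_time_shift h))
  -- A shear is a translation on each fibre, so it preserves measure; this gives the joint
  -- integrability in (θ, x, s) that Fubini requires.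
  have hmp : MeasurePreserving (fun q : ℝ × (X × ℝ) => (q.1, (q.2.1, q.2.2 + h * q.1)))
      ((volume.restrict (Ioc (0 : ℝ) 1)).prod (m.prod volume))
      ((volume.restrict (Ioc (0 : ℝ) 1)).prod (m.prod volume)) := by
    refine (MeasurePreserving.id _).skew_product
      (g := fun θ (p : X × ℝ) => (p.1, p.2 + h * θ)) ?_ ?_
    · unfold Function.uncurry; fun_prop
    · exact .of_forall fun θ => (measurePreserving_time_shift (h * θ)).map_eq
  have hA3 := (hA.comp_snd (volume.restrict (Ioc (0 : ℝ) 1))).comp_measurePreserving hmp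
  have hV3 := hVs.comp_snd (volume.restrict (Ioc (0 : ℝ) 1))
  have hint : Integrable (fun q : ℝ × (X × ℝ) =>
      ⟪A (q.2.1, q.2.2 + h * q.1), V q.2 + V (q.2.1, q.2.2 + h)⟫)
      ((volume.restrict (Ioc (0 : ℝ) 1)).prod ((m.prod volume).restrict (D ×ˢ Ioc 0 t))) := by
    have := integrable_inner_of_memLp hA3 hV3
    refine this.mono_measure ?_
    exact Measure.prod_mono le_rfl Measure.restrict_le_self
  have hint2 : Integrable (fun q : ℝ × (X × ℝ) =>
      ⟪A (q.2.1, q.2.2 + h * q.1), V q.2 + V (q.2.1, q.2.2 + h)⟫)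
      ((volume.restrict (Ioc (0 : ℝ) 1)).prod ((m.restrict D).prod
        (volume.restrict (Ioc 0 t)))) := by
    rwa [Measure.prod_restrict]
  -- integrate in the order `s`, `θ`, `x`
  have e1 : ∫ θ in (0 : ℝ)..1, ∫ p in D ×ˢ Ioc 0 t,
        ⟪A (p.1, p.2 + h * θ), V p + V (p.1, p.2 + h)⟫ ∂(m.prod volume)
      = ∫ s in Ioc 0 t, ∫ θ in Ioc (0 : ℝ) 1, ∫ x in D,
          ⟪A (x, s + h * θ), V (x, s) + V (x, s + h)⟫ ∂m := by
    rw [intervalIntegral.integral_of_le zero_le_one]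
    simp_rw [← Measure.prod_restrict]
    have hsw : Integrable (Function.uncurry fun (θ s : ℝ) => ∫ x in D,
        ⟪A (x, s + h * θ), V (x, s) + V (x, s + h)⟫ ∂m)
        ((volume.restrict (Ioc (0 : ℝ) 1)).prod (volume.restrict (Ioc 0 t))) := by
      have h1 : MeasurePreserving (fun q : (ℝ × ℝ) × X => (q.1.1, (q.2, q.1.2)))
          (((volume.restrict (Ioc (0 : ℝ) 1)).prod (volume.restrict (Ioc 0 t))).prod
            (m.restrict D))
          ((volume.restrict (Ioc (0 : ℝ) 1)).prod ((m.restrict D).prod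
            (volume.restrict (Ioc 0 t)))) :=
        ((MeasurePreserving.id _).prod Measure.measurePreserving_swap).comp
          (measurePreserving_prodAssoc _ _ _)
      exact (h1.integrable_comp_of_integrable hint2).integral_prod_left
    rw [← integral_integral_swap hsw]
    refine integral_congr_ae ?_
    filter_upwards [hint2.prod_right_ae] with θ hθ
    rw [integral_prod_symm _ hθ]
  rw [e1, intervalIntegral.integral_of_le ht, ← integral_const_mul]
  refine integral_congr_ae (.of_forall fun s => ?_)
  -- Substitution r = s + hθ; the factor h on the left is its Jacobian.
  have := intervalIntegral.smul_integral_comp_add_mul (a := 0) (b := 1)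
    (fun r => ∫ x in D, ⟪A (x, r), V (x, s) + V (x, s + h)⟫ ∂m) h s
  simp only [mul_zero, add_zero, mul_one, smul_eq_mul] at this
  simp only
  rw [← this, intervalIntegral.integral_of_le zero_le_one]

section Identity

variable {X : Type*} [NormedAddCommGroup X] [NormedSpace ℝ X] [FiniteDimensional ℝ X]
  [MeasurableSpace X] [BorelSpace X] {m : Measure X} [m.IsAddHaarMeasure]
  {H : Type*} [NormedAddCommGroup H] [InnerProductSpace ℝ H]

/-- Space-time integrals of products of time translates are jointly continuous in the shifts. -/
theorem continuous_integral_inner_time_shift {A V : X × ℝ → H}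
    (hA : MemLp A 2 (m.prod volume)) (hV : MemLp V 2 (m.prod volume)) (S : Set (X × ℝ)) :
    Continuous (fun c : ℝ × ℝ => ∫ p in S, ⟪A (p.1, p.2 + c.1), V p + V (p.1, p.2 + c.2)⟫
      ∂(m.prod volume)) := by
  -- Translations act continuously on Lᵖ for finite p, so the integral is an inner product of two
  -- continuous orbit maps in L².
  let τ : ℝ → (X × ℝ)ᵈᵃᵃ := fun c => DomAddAct.mk ((0 : X), c)
  have hτ : Continuous τ := DomAddAct.continuous_mk.comp (by fun_prop)
  let a := hA.toLp A
  let v := hV.toLp V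
  have : Fact ((2 : ℝ≥0∞) ≠ ⊤) := ⟨by simp⟩
  let R := LpToLpRestrictCLM (X × ℝ) H ℝ (m.prod volume) 2 S
  have key : Continuous (fun c : ℝ × ℝ => ⟪R (τ c.1 +ᵥ a), R (v + (τ c.2 +ᵥ v))⟫) := by
    refine (R.continuous.comp ?_).inner (R.continuous.comp (continuous_const.add ?_))
    · exact (hτ.comp continuous_fst).vadd continuous_const
    · exact (hτ.comp continuous_snd).vadd continuous_const
  have shift : ∀ {f : X × ℝ → H} (hf : MemLp f 2 (m.prod volume)) (c : ℝ),
      (τ c +ᵥ hf.toLp f : Lp H 2 (m.prod volume)) =ᵐ[m.prod volume]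
        fun p => f (p.1, p.2 + c) := by
    intro f hf c
    refine (DomAddAct.vadd_Lp_ae_eq _ _).trans ?_
    have := (measurePreserving_time_shift (m := m) c).quasiMeasurePreserving.ae hf.coeFn_toLp
    filter_upwards [this] with p hp
    rw [← hp]
    simp [τ, add_comm c, vadd_eq_add, Prod.add_def]
  convert key using 2 with c
  rw [L2.inner_def]
  refine integral_congr_ae ?_
  filter_upwards [LpToLpRestrictCLM_coeFn ℝ S (τ c.1 +ᵥ a),
    LpToLpRestrictCLM_coeFn ℝ S (v + (τ c.2 +ᵥ v)),
    ae_restrict_of_ae (shift hA c.1), ae_restrict_of_ae (shift hV c.2),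
    ae_restrict_of_ae hV.coeFn_toLp, ae_restrict_of_ae (Lp.coeFn_add v (τ c.2 +ᵥ v))]
    with p h1 h2 h3 h4 h5 h6
  rw [h1, h2, h3, h6, Pi.add_apply, h4, h5]

/-- The energy identity: if the increments of `E` are the time integrals of the pairing of `A` with
the sum of the two endpoint values of `V`, then `E` has derivative `2 ⟪A, V⟫` in integrated form. -/
theorem energy_identity {A V : X × ℝ → H}
    (hA : MemLp A 2 (m.prod volume)) (hV : MemLp V 2 (m.prod volume)) (D : Set X)
    {T : ℝ} {E : ℝ → ℝ} (hE : ContinuousOn E (Icc 0 T))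
    (hinc : ∀ h > 0, ∀ᵐ s, s ∈ Ioo 0 (T - h) → E (s + h) - E s =
      ∫ r in s..s + h, ∫ x in D, ⟪A (x, r), V (x, s) + V (x, s + h)⟫ ∂m)
    {t : ℝ} (ht : t ∈ Ioo 0 T) :
    E t - E 0 = 2 * ∫ s in (0 : ℝ)..t, ∫ x in D, ⟪A (x, s), V (x, s)⟫ ∂m := by
  obtain ⟨ht0, htT⟩ := ht
  have hT : 0 ≤ T := ht0.le.trans htT.le
  -- Extending by constants beyond [0,T] makes the primitive `Φ` differentiable on both sides of 0.
  let E' : ℝ → ℝ := IccExtend hT ((Icc 0 T).domRestrict E)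
  have hE'c : Continuous E' := (continuousOn_iff_continuous_domRestrict.1 hE).Icc_extend'
  have hE'e : ∀ s ∈ Icc 0 T, E' s = E s := fun s hs => by
    simp [E', IccExtend_of_mem _ _ hs, Set.domRestrict]
  let Φ : ℝ → ℝ := fun y => ∫ s in (0 : ℝ)..y, E' s
  have hΦ : ∀ y, HasDerivAt Φ (E' y) y := fun y =>
    intervalIntegral.integral_hasDerivAt_right (hE'c.intervalIntegrable _ _)
      (hE'c.stronglyMeasurableAtFilter _ _) hE'c.continuousAt
  -- For small h > 0 this is h⁻¹ times the integral of E(s+h) − E(s) over (0,t). Written as an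
  -- average over θ it has no singularity at h = 0, where both shifts vanish and the two copies of
  -- `V` give the factor 2.
  let J : ℝ → ℝ := fun h => ∫ θ in (0 : ℝ)..1, ∫ p in D ×ˢ Ioc 0 t,
    ⟪A (p.1, p.2 + h * θ), V p + V (p.1, p.2 + h)⟫ ∂(m.prod volume)
  have hJ : Continuous J := by
    refine intervalIntegral.continuous_parametric_intervalIntegral_of_continuous' ?_ 0 1
    exact (continuous_integral_inner_time_shift hA hV (D ×ˢ Ioc 0 t)).comp
      (f := fun c : ℝ × ℝ => (c.1 * c.2, c.1)) (by fun_prop)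
  have hJ0 : J 0 = 2 * ∫ s in (0 : ℝ)..t, ∫ x in D, ⟪A (x, s), V (x, s)⟫ ∂m := by
    simp only [J, zero_mul, add_zero, inner_add_right, ← two_mul, integral_const_mul]
    rw [intervalIntegral.integral_const]
    simp only [sub_zero, one_smul]
    rw [intervalIntegral.integral_of_le ht0.le, ← Measure.prod_restrict, integral_prod_symm]
    have := integrable_inner_of_memLp hA hV
    rw [Measure.prod_restrict]
    exact this.integrableOn
  have hq : ∀ h ∈ Ioo 0 (T - t), h⁻¹ • (Φ (t + h) - Φ t) - h⁻¹ • (Φ (0 + h) - Φ 0) = J h := by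
    intro h hh
    have h1 := integral_integral_inner_time_shift hA hV D ht0.le h
    have h2 : Φ (t + h) - Φ t - (Φ (0 + h) - Φ 0) = h * J h := by
      rw [show h * J h = _ from h1]
      have h3 : ∫ s in (0 : ℝ)..t, ∫ r in s..s + h, ∫ x in D,
          ⟪A (x, r), V (x, s) + V (x, s + h)⟫ ∂m = ∫ s in (0 : ℝ)..t, (E' (s + h) - E' s) := by
        refine intervalIntegral.integral_congr_ae ?_
        filter_upwards [hinc h hh.1] with s hs hst
        rw [uIoc_of_le ht0.le] at hst
        have := hh.2
        rw [← hs ⟨hst.1, by linarith [hst.2]⟩, hE'e, hE'e]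
        · exact ⟨hst.1.le, by linarith [hst.2]⟩
        · exact ⟨by linarith [hst.1, hh.1], by linarith [hst.2]⟩
      rw [h3]
      have hE's : Continuous fun s => E' (s + h) := hE'c.comp (by fun_prop)
      rw [intervalIntegral.integral_sub (hE's.intervalIntegrable _ _)
        (hE'c.intervalIntegrable _ _), intervalIntegral.integral_comp_add_right]
      have h4 : Φ (t + h) = Φ (0 + h) + ∫ s in (0 + h)..(t + h), E' s :=
        (intervalIntegral.integral_add_adjacent_intervals (hE'c.intervalIntegrable _ _)
          (hE'c.intervalIntegrable _ _)).symm
      rw [h4]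
      simp only [Φ, intervalIntegral.integral_same]
      ring
    rw [← smul_sub, h2, smul_eq_mul, inv_mul_cancel_left₀ hh.1.ne']
  have hlim : Tendsto (fun h => h⁻¹ • (Φ (t + h) - Φ t) - h⁻¹ • (Φ (0 + h) - Φ 0)) (𝓝[>] 0)
      (𝓝 (E' t - E' 0)) :=
    ((hΦ t).tendsto_slope_zero_right).sub ((hΦ 0).tendsto_slope_zero_right)
  have hlim2 : Tendsto J (𝓝[>] 0) (𝓝 (E' t - E' 0)) := by
    refine hlim.congr' ?_
    filter_upwards [Ioo_mem_nhdsGT (show (0 : ℝ) < T - t by linarith)] with h hh using hq h hh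
  have := tendsto_nhds_unique hlim2 (hJ.continuousWithinAt (s := Ioi 0) (x := 0))
  rw [← hE'e t ⟨ht0.le, htT.le⟩, ← hE'e 0 ⟨le_rfl, hT⟩, this, hJ0]

end Identity

/-! ### Coefficient bounds, and the equation as a pairing of flux and state -/

theorem abs_entry_le_frobenius {n : ℕ} (A : Matrix (Fin n) (Fin n) ℝ) (i j : Fin n) :
    |A i j| ≤ frobenius A := by
  refine Real.abs_le_sqrt ?_
  calc A i j ^ 2 ≤ ∑ j, A i j ^ 2 :=
        Finset.single_le_sum (f := fun j => A i j ^ 2) (fun _ _ => sq_nonneg _) (Finset.mem_univ j)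
    _ ≤ _ := Finset.single_le_sum (f := fun i => ∑ j, A i j ^ 2)
        (fun _ _ => Finset.sum_nonneg fun _ _ => sq_nonneg _) (Finset.mem_univ i)

theorem frobenius_nonneg {n : ℕ} (A : Matrix (Fin n) (Fin n) ℝ) : 0 ≤ frobenius A :=
  Real.sqrt_nonneg _

theorem aemeasurable_det {α ι : Type*} [Fintype ι] [DecidableEq ι] {mα : MeasurableSpace α}
    {ν : Measure α} {B : α → Matrix ι ι ℝ} (hB : ∀ i j, AEMeasurable (fun a => B a i j) ν) :
    AEMeasurable (fun a => (B a).det) ν := by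
  simp only [Matrix.det_apply]
  refine Finset.aemeasurable_fun_sum _ fun σ _ => ?_
  exact (Finset.aemeasurable_fun_prod _ fun i _ => hB _ _).const_smul (Equiv.Perm.sign σ)

/-- Cramer's formula: measurability of b⁻¹ is not among the assumptions and must come from that of
b. -/
theorem aemeasurable_inv_entry {α ι : Type*} [Fintype ι] [DecidableEq ι] {mα : MeasurableSpace α}
    {ν : Measure α} {B : α → Matrix ι ι ℝ} (hB : ∀ i j, AEMeasurable (fun a => B a i j) ν)
    (i j : ι) : AEMeasurable (fun a => (B a)⁻¹ i j) ν := by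
  simp only [Matrix.inv_def, Ring.inverse_eq_inv', Matrix.smul_apply, smul_eq_mul,
    Matrix.adjugate_apply]
  refine (aemeasurable_det hB).inv.mul (aemeasurable_det fun k l => ?_)
  by_cases hk : k = j
  · subst hk; simp
  · simpa [Matrix.updateRow_ne hk] using hB k l

namespace Parameters

variable (μ : Parameters)

/-- The Lebesgue measure on the cylinder. -/
noncomputable abbrev cylMeasure : Measure (Rn μ.n × ℝ) := volume.restrict (cylinder μ.D μ.T)

theorem measurableSet_cylinder : MeasurableSet (cylinder μ.D μ.T) :=
  μ.domain.isOpen.measurableSet.prod measurableSet_Ioo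

theorem bound_lt_top : μ.reduced.bound < ⊤ := by
  refine lt_of_le_of_lt (essSup_mono_ae (.of_forall fun p => ?_)) μ.bounded
  refine ENNReal.ofReal_le_ofReal ?_
  linarith [frobenius_nonneg (μ.b p)⁻¹]

theorem ae_coeff_le_bound : ∀ᵐ p ∂μ.cylMeasure,
    frobenius (μ.b p) + ‖μ.f p‖ + |μ.lam p| ≤ μ.reduced.bound.toReal := by
  filter_upwards [ENNReal.ae_le_essSup (μ := μ.cylMeasure)
    (fun p => ENNReal.ofReal (frobenius (μ.b p) + ‖μ.f p‖ + |μ.lam p|))] with p hp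
  exact (ENNReal.ofReal_le_iff_le_toReal μ.bound_lt_top.ne).1 hp

/-- Serves only to make F·b⁻¹F integrable. The constant never enters the choice of K, as it must
not: it is not part of the reduced parameters. -/
theorem exists_ae_inv_le : ∃ C, ∀ᵐ p ∂μ.cylMeasure, frobenius (μ.b p)⁻¹ ≤ C := by
  refine ⟨(essSup (fun p => ENNReal.ofReal
    (frobenius (μ.b p) + frobenius (μ.b p)⁻¹ + ‖μ.f p‖ + |μ.lam p|)) μ.cylMeasure).toReal, ?_⟩
  filter_upwards [ENNReal.ae_le_essSup (μ := μ.cylMeasure) (fun p => ENNReal.ofReal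
    (frobenius (μ.b p) + frobenius (μ.b p)⁻¹ + ‖μ.f p‖ + |μ.lam p|))] with p hp
  have := (ENNReal.ofReal_le_iff_le_toReal μ.bounded.ne).1 hp
  refine le_trans ?_ this
  linarith [frobenius_nonneg (μ.b p), norm_nonneg (μ.f p), abs_nonneg (μ.lam p)]

theorem memLp_b (i j : Fin μ.n) : MemLp (fun p => μ.b p i j) ⊤ μ.cylMeasure := by
  refine memLp_top_of_bound (μ.b_meas i j).aestronglyMeasurable μ.reduced.bound.toReal ?_
  filter_upwards [μ.ae_coeff_le_bound] with p hp
  have := abs_entry_le_frobenius (μ.b p) i j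
  rw [Real.norm_eq_abs]
  linarith [norm_nonneg (μ.f p), abs_nonneg (μ.lam p)]

theorem memLp_b_inv (i j : Fin μ.n) : MemLp (fun p => (μ.b p)⁻¹ i j) ⊤ μ.cylMeasure := by
  obtain ⟨C, hC⟩ := μ.exists_ae_inv_le
  refine memLp_top_of_bound (aemeasurable_inv_entry μ.b_meas i j).aestronglyMeasurable C ?_
  filter_upwards [hC] with p hp using (abs_entry_le_frobenius _ i j).trans hp

theorem memLp_f (i : Fin μ.n) : MemLp (fun p => μ.f p i) ⊤ μ.cylMeasure := by
  have h : MemLp μ.f ⊤ μ.cylMeasure := by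
    refine memLp_top_of_bound μ.f_meas.aestronglyMeasurable μ.reduced.bound.toReal ?_
    filter_upwards [μ.ae_coeff_le_bound] with p hp
    linarith [frobenius_nonneg (μ.b p), abs_nonneg (μ.lam p)]
  exact h.eval_piLp i

theorem memLp_lam : MemLp μ.lam ⊤ μ.cylMeasure := by
  refine memLp_top_of_bound μ.lam_meas.aestronglyMeasurable μ.reduced.bound.toReal ?_
  filter_upwards [μ.ae_coeff_le_bound] with p hp
  rw [Real.norm_eq_abs]
  linarith [frobenius_nonneg (μ.b p), norm_nonneg (μ.f p)]

/-- Matrices with bounded entries act on square integrable vector fields. -/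
theorem memLp_mulVec {B : Rn μ.n × ℝ → Matrix (Fin μ.n) (Fin μ.n) ℝ}
    (hB : ∀ i j, MemLp (fun p => B p i j) ⊤ μ.cylMeasure) {F : Rn μ.n × ℝ → Rn μ.n}
    (hF : MemLp F 2 μ.cylMeasure) :
    MemLp (fun p => WithLp.toLp 2 (B p *ᵥ (F p).ofLp) : Rn μ.n × ℝ → Rn μ.n) 2 μ.cylMeasure := by
  refine MemLp.of_eval_piLp fun i => ?_
  simp only [Matrix.mulVec, dotProduct]
  exact memLp_finsetSum _ fun j _ => (hF.eval_piLp j).mul' (hB i j)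

/-- The quadratic form of the inverse diffusion matrix is integrable on square integrable fields. -/
theorem integrable_inv_form {F : Rn μ.n × ℝ → Rn μ.n} (hF : MemLp F 2 μ.cylMeasure) :
    Integrable (fun p => (F p).ofLp ⬝ᵥ ((μ.b p)⁻¹ *ᵥ (F p).ofLp)) μ.cylMeasure := by
  refine (integrable_inner_of_memLp (μ.memLp_mulVec μ.memLp_b_inv hF) hF).congr
    (.of_forall fun p => ?_)
  simp [EuclideanSpace.inner_eq_star_dotProduct]

/-- The space of pairs (gradient, value). -/
abbrev State : Type := WithLp 2 (Rn μ.n × ℝ)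

/-- The pair (gradient, value) of a function on the cylinder, extended by zero. -/
noncomputable def state (u : Rn μ.n × ℝ → ℝ) (G : Rn μ.n × ℝ → Rn μ.n) : Rn μ.n × ℝ → μ.State :=
  (cylinder μ.D μ.T).indicator fun p => WithLp.toLp 2 (G p, u p)

/-- The right-hand side of the equation as a functional on pairs (gradient, value), extended by
zero outside the cylinder. -/
noncomputable def flux (F : Rn μ.n × ℝ → Rn μ.n) (F₀ u : Rn μ.n × ℝ → ℝ)
    (G : Rn μ.n × ℝ → Rn μ.n) : Rn μ.n × ℝ → μ.State :=
  (cylinder μ.D μ.T).indicator fun p => WithLp.toLp 2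
    (-(WithLp.toLp 2 (μ.b p *ᵥ (G p).ofLp) + F p),
      (∑ i, μ.f p i * G p i) + μ.lam p * u p + F₀ p)

variable {F G : Rn μ.n × ℝ → Rn μ.n} {F₀ u : Rn μ.n × ℝ → ℝ}

theorem memLp_state (hu : MemLp u 2 μ.cylMeasure) (hG : MemLp G 2 μ.cylMeasure) :
    MemLp (μ.state u G) 2 (volume.prod volume) := by
  refine (memLp_indicator_iff_restrict μ.measurableSet_cylinder).2 ?_
  exact MemLp.of_fst_of_snd_prodLp ⟨hG, hu⟩

theorem memLp_flux (hF : MemLp F 2 μ.cylMeasure) (hF₀ : MemLp F₀ 2 μ.cylMeasure)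
    (hu : MemLp u 2 μ.cylMeasure) (hG : MemLp G 2 μ.cylMeasure) :
    MemLp (μ.flux F F₀ u G) 2 (volume.prod volume) := by
  refine (memLp_indicator_iff_restrict μ.measurableSet_cylinder).2 ?_
  refine MemLp.of_fst_of_snd_prodLp ⟨?_, ?_⟩
  · exact ((μ.memLp_mulVec μ.memLp_b hG).add hF).neg
  · refine ((memLp_finsetSum _ fun i _ => ?_).add (hu.mul' μ.memLp_lam)).add hF₀
    exact (hG.eval_piLp i).mul' (μ.memLp_f i)

theorem state_apply {x : Rn μ.n} {s : ℝ} (hx : x ∈ μ.D) (hs : s ∈ Ioo 0 μ.T) :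
    μ.state u G (x, s) = WithLp.toLp 2 (G (x, s), u (x, s)) :=
  indicator_of_mem (show (x, s) ∈ cylinder μ.D μ.T from ⟨hx, hs⟩) _

/-- Turns the integrand of the weak formulation into a single inner product, the form in which the
abstract energy identity applies. -/
theorem inner_flux {x : Rn μ.n} {s : ℝ} (hx : x ∈ μ.D) (hs : s ∈ Ioo 0 μ.T) (g : Rn μ.n) (w : ℝ) :
    ⟪μ.flux F F₀ u G (x, s), (WithLp.toLp 2 (g, w) : μ.State)⟫ =
      - (∑ i, ((∑ j, μ.b (x, s) i j * G (x, s) j) + F (x, s) i) * g i)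
        + ((∑ i, μ.f (x, s) i * G (x, s) i) + μ.lam (x, s) * u (x, s) + F₀ (x, s)) * w := by
  rw [flux, indicator_of_mem (show (x, s) ∈ cylinder μ.D μ.T from ⟨hx, hs⟩),
    WithLp.prod_inner_apply]
  simp only [inner_neg_left]
  refine congrArg₂ (· + ·) (congrArg Neg.neg ?_) ?_
  · simp [PiLp.inner_apply, Matrix.mulVec, dotProduct, mul_comm]
  · simp [mul_comm]

/-- The pairing of a space-time field with a fixed square integrable function on `D` is integrable
on bounded time intervals. -/
theorem intervalIntegrable_pairing {A : Rn μ.n × ℝ → μ.State}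
    (hA : MemLp A 2 (volume.prod volume)) {W : Rn μ.n → μ.State}
    (hW : MemLp W 2 (volume.restrict μ.D)) (a b : ℝ) :
    IntervalIntegrable (fun r => ∫ x in μ.D, ⟪A (x, r), W x⟫) volume a b := by
  rw [intervalIntegrable_iff]
  have : IsFiniteMeasure ((volume : Measure ℝ).restrict (uIoc a b)) := by
    unfold uIoc; infer_instance
  have h1 : MemLp (fun p : Rn μ.n × ℝ => W p.1) 2
      ((volume.restrict μ.D).prod (volume.restrict (uIoc a b))) :=
    hW.comp_fst (volume.restrict (uIoc a b))
  have h2 : MemLp A 2 ((volume.restrict μ.D).prod (volume.restrict (uIoc a b))) :=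
    hA.mono_measure (Measure.prod_mono Measure.restrict_le_self Measure.restrict_le_self)
  exact (integrable_inner_of_memLp h2 h1).integral_prod_right

/-- For almost every time, the pairing of a space-time field with every square integrable
function is integrable over `D`. -/
theorem ae_integrable_pairing {A : Rn μ.n × ℝ → μ.State}
    (hA : MemLp A 2 (volume.prod volume)) :
    ∀ᵐ r, ∀ W : Rn μ.n → μ.State, MemLp W 2 (volume.restrict μ.D) →
      Integrable (fun x => ⟪A (x, r), W x⟫) (volume.restrict μ.D) := by
  have hm : ∀ᵐ r, AEStronglyMeasurable (fun x => A (x, r)) (volume : Measure (Rn μ.n)) :=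
    hA.1.prodMk_right
  have hi := (hA.integrable_norm_pow (by norm_num)).prod_left_ae
  filter_upwards [hm, hi] with r h1 h2 W hW
  refine integrable_inner_of_memLp (MemLp.restrict _ ?_) hW
  refine (memLp_two_iff_integrable_sq_norm h1).2 ?_
  simpa using h2

end Parameters

/-! ### Energy identity for weak solutions -/

theorem MemC0.continuousOn_energy {n : ℕ} {D : Set (Rn n)} {T : ℝ} {u : Rn n × ℝ → ℝ}
    (hu : MemC0 D T u) : ContinuousOn (fun t => ∫ x in D, u (x, t) ^ 2) (Icc 0 T) := by
  rw [continuousOn_iff_continuous_domRestrict]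
  let U : Icc 0 T → Lp ℝ 2 (volume.restrict D) := fun t => (hu.memLp t t.2).toLp _
  have hU : Continuous U := by
    refine continuous_iff_continuousAt.2 fun t => ?_
    refine (Lp.tendsto_Lp_iff_tendsto_eLpNorm'' _ _ _ _).2 ?_
    exact (hu.continuous t t.2).comp (tendsto_nhdsWithin_iff.2
      ⟨continuous_subtype_val.continuousAt, .of_forall fun s => s.2⟩)
  have h2 : Continuous fun t => ⟪U t, U t⟫ := hU.inner hU
  convert h2 using 2 with t
  rw [L2.inner_def]
  refine integral_congr_ae ?_
  filter_upwards [(hu.memLp t t.2).coeFn_toLp] with x hx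
  rw [hx]
  simp [pow_two]

theorem MemH1.memLp_toLp {n : ℕ} {D : Set (Rn n)} {w : Rn n → ℝ} {g : Rn n → Rn n}
    (hw : MemH1 D w g) :
    MemLp (fun x => (WithLp.toLp 2 (g x, w x) : WithLp 2 (Rn n × ℝ))) 2 (volume.restrict D) :=
  MemLp.of_fst_of_snd_prodLp ⟨hw.memW12.memLp_grad, hw.memW12.memLp⟩

/-- The energy identity for weak solutions. -/
theorem IsSolution.energy_identity {μ : Parameters} {F : Rn μ.n × ℝ → Rn μ.n}
    {F₀ u : Rn μ.n × ℝ → ℝ} (hF : MemLp F 2 μ.cylMeasure) (hF₀ : MemLp F₀ 2 μ.cylMeasure)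
    (hu : IsSolution μ F F₀ u) :
    ∃ G : Rn μ.n × ℝ → Rn μ.n, MemX1 μ.D μ.T u G ∧ ∀ t ∈ Ioo 0 μ.T,
      ∫ x in μ.D, u (x, t) ^ 2 =
        2 * ∫ s in (0 : ℝ)..t, ∫ x in μ.D, ⟪μ.flux F F₀ u G (x, s), μ.state u G (x, s)⟫ := by
  obtain ⟨hC, h0, G, hX, hweak⟩ := hu
  refine ⟨G, hX, fun t ht => ?_⟩
  have hD : MeasurableSet μ.D := μ.domain.isOpen.measurableSet
  set A := μ.flux F F₀ u G with hAdef
  have hA : MemLp A 2 (volume.prod volume) := μ.memLp_flux hF hF₀ hX.memLp hX.memLp_grad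
  have hV := μ.memLp_state hX.memLp hX.memLp_grad
  have key : ∀ (w : Rn μ.n → ℝ) (g : Rn μ.n → Rn μ.n), MemH1 μ.D w g → ∀ t ∈ Icc 0 μ.T,
      ∫ x in μ.D, u (x, t) * w x =
        ∫ s in (0 : ℝ)..t, ∫ x in μ.D, ⟪A (x, s), WithLp.toLp 2 (g x, w x)⟫ := by
    intro w g hw t ht
    rw [hweak w g hw t ht]
    refine intervalIntegral.integral_congr_ae ?_
    -- The time s = T lies outside the open cylinder, where the flux was set to zero.
    filter_upwards [Measure.ae_ne volume μ.T] with s hs hst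
    rw [uIoc_of_le ht.1] at hst
    have hs' : s ∈ Ioo 0 μ.T := ⟨hst.1, lt_of_le_of_ne (hst.2.trans ht.2) hs⟩
    exact setIntegral_congr_fun hD fun x hx => (μ.inner_flux hx hs' _ _).symm
  have incr : ∀ (w : Rn μ.n → ℝ) (g : Rn μ.n → Rn μ.n), MemH1 μ.D w g →
      ∀ a ∈ Icc 0 μ.T, ∀ b ∈ Icc 0 μ.T,
      (∫ x in μ.D, u (x, b) * w x) - ∫ x in μ.D, u (x, a) * w x =
        ∫ r in a..b, ∫ x in μ.D, ⟪A (x, r), WithLp.toLp 2 (g x, w x)⟫ := by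
    intro w g hw a ha b hb
    rw [key w g hw a ha, key w g hw b hb]
    exact intervalIntegral.integral_interval_sub_left
      (μ.intervalIntegrable_pairing hA hw.memLp_toLp _ _)
      (μ.intervalIntegrable_pairing hA hw.memLp_toLp _ _)
  have hslice := (ae_restrict_iff' measurableSet_Ioo).1 hX.slice
  have hinc : ∀ h > 0, ∀ᵐ s, s ∈ Ioo 0 (μ.T - h) →
      (∫ x in μ.D, u (x, s + h) ^ 2) - ∫ x in μ.D, u (x, s) ^ 2 =
      ∫ r in s..s + h, ∫ x in μ.D, ⟪A (x, r), μ.state u G (x, s) + μ.state u G (x, s + h)⟫ := by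
    intro h hh
    -- The exceptional null set and its translate by −h are both discarded, so the slices at s and
    -- at s + h both lie in H¹ and can be used as test functions.
    filter_upwards [hslice,
      (measurePreserving_add_right volume h).quasiMeasurePreserving.ae hslice] with s h1 h2 hs
    have hs1 : s ∈ Ioo 0 μ.T := ⟨hs.1, by linarith [hs.2]⟩
    have hs2 : s + h ∈ Ioo 0 μ.T := ⟨by linarith [hs.1], by linarith [hs.2]⟩
    have w1 := h1 hs1
    have w2 := h2 hs2
    have e1 := incr _ _ w1 s (Ioo_subset_Icc_self hs1) _ (Ioo_subset_Icc_self hs2)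
    have e2 := incr _ _ w2 s (Ioo_subset_Icc_self hs1) _ (Ioo_subset_Icc_self hs2)
    have e3 : ∫ r in s..s + h, ∫ x in μ.D,
        ⟪A (x, r), μ.state u G (x, s) + μ.state u G (x, s + h)⟫ =
        (∫ r in s..s + h, ∫ x in μ.D, ⟪A (x, r), WithLp.toLp 2 (G (x, s), u (x, s))⟫) +
        ∫ r in s..s + h, ∫ x in μ.D,
          ⟪A (x, r), WithLp.toLp 2 (G (x, s + h), u (x, s + h))⟫ := by
      rw [← intervalIntegral.integral_add
        (μ.intervalIntegrable_pairing hA w1.memLp_toLp _ _)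
        (μ.intervalIntegrable_pairing hA w2.memLp_toLp _ _)]
      refine intervalIntegral.integral_congr_ae ?_
      filter_upwards [μ.ae_integrable_pairing hA] with r hr _
      rw [← integral_add (hr _ w1.memLp_toLp) (hr _ w2.memLp_toLp)]
      refine setIntegral_congr_fun hD fun x hx => ?_
      simp only [μ.state_apply hx hs1, μ.state_apply hx hs2, inner_add_right]
    rw [e3, ← e1, ← e2]
    -- The mixed products ∫ u(s)u(s+h) cancel, leaving the difference of squares.
    simp only [pow_two, mul_comm (u (_, s + h)) (u (_, s))]
    ring
  have hE0 : ∫ x in μ.D, u (x, 0) ^ 2 = 0 := by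
    refine integral_eq_zero_of_ae ?_
    filter_upwards [h0] with x hx
    simp [hx]
  have := Parabolic.energy_identity hA hV μ.D hC.continuousOn_energy hinc ht
  rwa [hE0, sub_zero] at this

/-! ### Exponential weight, Young's inequality and the pointwise estimate -/

/-- Integration by parts against an exponential weight. -/
theorem exp_mul_integral_eq {h : ℝ → ℝ} {t : ℝ} (hh : IntervalIntegrable h volume 0 t) (κ : ℝ) :
    Real.exp (κ * t) * ∫ s in (0 : ℝ)..t, h s =
      ∫ s in (0 : ℝ)..t, Real.exp (κ * s) * (h s + κ * ∫ r in (0 : ℝ)..s, h r) := by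
  have hd : ∀ s, HasDerivAt (fun s => Real.exp (κ * s)) (Real.exp (κ * s) * κ) s := fun s => by
    simpa using ((hasDerivAt_id s).const_mul κ).exp
  -- `h` is only integrable, so the product rule is used in its absolutely continuous form.
  have hg : AbsolutelyContinuousOnInterval (fun s => ∫ r in (0 : ℝ)..s, h r) 0 t :=
    hh.absolutelyContinuousOnInterval_intervalIntegral left_mem_uIcc
  have hec : Continuous fun s => Real.exp (κ * s) * κ := by fun_prop
  have hf : AbsolutelyContinuousOnInterval (fun s => Real.exp (κ * s)) 0 t := by
    have := (hec.intervalIntegrable (μ := volume) 0 t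
      ).absolutelyContinuousOnInterval_intervalIntegral (c := 0) left_mem_uIcc
    have h2 := (LipschitzWith.const (α := ℝ) (1 : ℝ)).lipschitzOnWith
      (s := uIcc 0 t) |>.absolutelyContinuousOnInterval.fun_add this
    have hfun : (fun s => Real.exp (κ * s)) =
        fun s => 1 + ∫ v in (0 : ℝ)..s, Real.exp (κ * v) * κ := by
      funext s
      rw [intervalIntegral.integral_eq_sub_of_hasDerivAt (fun x _ => hd x)
        (hec.intervalIntegrable _ _)]
      simp
    rwa [hfun]
  have := hf.integral_deriv_mul_eq_sub hg
  simp only [intervalIntegral.integral_same, mul_zero, sub_zero] at this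
  rw [← this]
  refine intervalIntegral.integral_congr_ae ?_
  filter_upwards [hh.ae_hasDerivAt_integral] with s hs hst
  rw [(hd s).deriv, (hs (uIoc_subset_uIcc hst) 0 left_mem_uIcc).deriv]
  ring

/-- Young's inequality for the quadratic form of a symmetric positive definite matrix and its
inverse. -/
theorem young_form {ι : Type*} [Fintype ι] [DecidableEq ι] {B : Matrix ι ι ℝ} (hs : B.IsSymm)
    (hpos : ∀ v : ι → ℝ, v ≠ 0 → 0 < v ⬝ᵥ (B *ᵥ v)) {c : ℝ} (hc : 0 < c) (g v : ι → ℝ) :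
    -2 * (g ⬝ᵥ v) ≤ c⁻¹ * (g ⬝ᵥ (B *ᵥ g)) + c * (v ⬝ᵥ (B⁻¹ *ᵥ v)) := by
  have hdet : IsUnit B.det := by
    refine isUnit_iff_ne_zero.2 fun h0 => ?_
    obtain ⟨w, hw, hBw⟩ := Matrix.exists_mulVec_eq_zero_iff.2 h0
    have := hpos w hw
    simp [hBw] at this
  set η := B⁻¹ *ᵥ v with hη
  have hv : B *ᵥ η = v := by
    rw [hη, Matrix.mulVec_mulVec, Matrix.mul_nonsing_inv _ hdet, Matrix.one_mulVec]
  -- Completing the square: this form, expanded and divided by c, is the claim.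
  have hnn : 0 ≤ (g + c • η) ⬝ᵥ (B *ᵥ (g + c • η)) := by
    by_cases h : g + c • η = 0
    · simp [h]
    · exact (hpos _ h).le
  have hsym : η ⬝ᵥ (B *ᵥ g) = g ⬝ᵥ v := by
    rw [Matrix.dotProduct_mulVec, ← Matrix.mulVec_transpose, hs.eq, hv, dotProduct_comm]
  have hexp : (g + c • η) ⬝ᵥ (B *ᵥ (g + c • η)) =
      g ⬝ᵥ (B *ᵥ g) + 2 * c * (g ⬝ᵥ v) + c ^ 2 * (v ⬝ᵥ η) := by
    simp only [Matrix.mulVec_add, Matrix.mulVec_smul, hv, add_dotProduct, dotProduct_add,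
      smul_dotProduct, dotProduct_smul, smul_eq_mul, hsym, dotProduct_comm η v]
    ring
  rw [hexp] at hnn
  have h3 := mul_nonneg (inv_pos.2 hc).le hnn
  have h4 : c⁻¹ * (g ⬝ᵥ (B *ᵥ g) + 2 * c * (g ⬝ᵥ v) + c ^ 2 * (v ⬝ᵥ η)) =
      c⁻¹ * (g ⬝ᵥ (B *ᵥ g)) + 2 * (g ⬝ᵥ v) + c * (v ⬝ᵥ η) := by
    field_simp
  linarith

/-- The weight exponent from which on the energy estimate holds with constants `1 / 2 + ε`, `ε`. -/
noncomputable def weightThreshold (M ε δ Λ : ℝ) : ℝ :=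
  (M + Λ ^ 2 / (2 * (1 - (1 + 2 * ε)⁻¹) * δ) + 2 * Λ + ε⁻¹) / 2

theorem weightThreshold_nonneg {M ε δ Λ : ℝ} (hM : 0 ≤ M) (hε : 0 < ε) (hδ : 0 < δ)
    (hΛ : 0 ≤ Λ) : 0 ≤ weightThreshold M ε δ Λ := by
  have : 0 < 1 - (1 + 2 * ε)⁻¹ := sub_pos.2 (inv_lt_one_of_one_lt₀ (by linarith))
  unfold weightThreshold
  positivity

namespace Parameters

variable (μ : Parameters) {F G : Rn μ.n × ℝ → Rn μ.n} {F₀ u : Rn μ.n × ℝ → ℝ}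

/-- The pointwise form of the energy estimate. -/
theorem ae_two_inner_flux_le {M ε K : ℝ} (hε : 0 < ε)
    (hK : weightThreshold M ε μ.δ μ.reduced.bound.toReal ≤ K) :
    ∀ᵐ p ∂μ.cylMeasure, 2 * ⟪μ.flux F F₀ u G p, μ.state u G p⟫ ≤
      (2 * K - M) * u p ^ 2
        + (1 / 2 + ε) * ((F p).ofLp ⬝ᵥ ((μ.b p)⁻¹ *ᵥ (F p).ofLp)) + ε * F₀ p ^ 2 := by
  filter_upwards [μ.ae_coeff_le_bound, ae_restrict_mem μ.measurableSet_cylinder]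
    with ⟨x, s⟩ hp ⟨hx, hs⟩
  rw [μ.state_apply hx hs, μ.inner_flux hx hs]
  simp only at hx hs
  set p : Rn μ.n × ℝ := (x, s)
  have hpc : p ∈ cylinder μ.D μ.T := ⟨hx, hs⟩
  set Λ := μ.reduced.bound.toReal
  -- The fraction of the diffusion term spent on F: Young's weight 1/2 + ε has inverse 2θ < 2,
  -- leaving 2(1 − θ) for the drift.
  set θ := (1 + 2 * ε)⁻¹ with hθ
  have hθ1 : 0 < 1 - θ := sub_pos.2 (inv_lt_one_of_one_lt₀ (by linarith))
  have hδ := μ.δ_pos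
  have hco := μ.coercive p hpc
  have hpos : ∀ v : Fin μ.n → ℝ, v ≠ 0 → 0 < v ⬝ᵥ (μ.b p *ᵥ v) := by
    intro v hv
    have h1 := hco (WithLp.toLp 2 v)
    have h2 : 0 < ‖(WithLp.toLp 2 v : Rn μ.n)‖ := norm_pos_iff.2 (by simpa using hv)
    have : 0 < μ.δ * ‖(WithLp.toLp 2 v : Rn μ.n)‖ ^ 2 := by positivity
    exact this.trans_le h1
  have hY := young_form (μ.b_symm p hpc) hpos (show 0 < 1 / 2 + ε by linarith)
    (G p).ofLp (F p).ofLp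
  have hc : (1 / 2 + ε)⁻¹ = 2 * θ := by
    rw [hθ]; field_simp
  rw [hc] at hY
  have e1 : ∑ i, ((∑ j, μ.b p i j * G p j) + F p i) * G p i =
      (G p).ofLp ⬝ᵥ (μ.b p *ᵥ (G p).ofLp) + (G p).ofLp ⬝ᵥ (F p).ofLp := by
    simp only [dotProduct, Matrix.mulVec, ← Finset.sum_add_distrib]
    exact Finset.sum_congr rfl fun i _ => by ring
  have e2 : ∑ i, μ.f p i * G p i = ⟪μ.f p, G p⟫ := by
    simp [PiLp.inner_apply, mul_comm]
  have hf : ‖μ.f p‖ ≤ Λ := by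
    linarith [frobenius_nonneg (μ.b p), abs_nonneg (μ.lam p)]
  have hl : μ.lam p ≤ Λ := by
    linarith [frobenius_nonneg (μ.b p), norm_nonneg (μ.f p), le_abs_self (μ.lam p)]
  have hΛ : 0 ≤ Λ := (norm_nonneg _).trans hf
  have h1 : 2 * (⟪μ.f p, G p⟫ * u p) ≤
      2 * (1 - θ) * μ.δ * ‖G p‖ ^ 2 + Λ ^ 2 / (2 * (1 - θ) * μ.δ) * u p ^ 2 := by
    set d := 2 * (1 - θ) * μ.δ with hd
    have hd0 : 0 < d := by positivity
    have i1 : ⟪μ.f p, G p⟫ * u p ≤ Λ * ‖G p‖ * |u p| := by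
      refine (le_abs_self _).trans ?_
      rw [abs_mul]
      have := abs_real_inner_le_norm (μ.f p) (G p)
      gcongr
      exact this.trans (by gcongr)
    have i2 : d * ‖G p‖ ^ 2 + Λ ^ 2 / d * u p ^ 2 - 2 * (Λ * ‖G p‖ * |u p|) =
        (d * ‖G p‖ - Λ * |u p|) ^ 2 / d := by
      rw [← sq_abs (u p)]
      field_simp
      ring
    have i3 : 0 ≤ (d * ‖G p‖ - Λ * |u p|) ^ 2 / d := by positivity
    linarith
  have h2 : 2 * (F₀ p * u p) ≤ ε * F₀ p ^ 2 + ε⁻¹ * u p ^ 2 := by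
    have i2 : ε * F₀ p ^ 2 + ε⁻¹ * u p ^ 2 - 2 * (F₀ p * u p) = (ε * F₀ p - u p) ^ 2 / ε := by
      field_simp
      ring
    have i3 : 0 ≤ (ε * F₀ p - u p) ^ 2 / ε := by positivity
    linarith
  have h3 : μ.lam p * u p ^ 2 ≤ Λ * u p ^ 2 := by gcongr
  have h4 : (1 - θ) * (μ.δ * ‖G p‖ ^ 2) ≤ (1 - θ) * ((G p).ofLp ⬝ᵥ (μ.b p *ᵥ (G p).ofLp)) := by
    exact mul_le_mul_of_nonneg_left (hco (G p)) hθ1.le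
  -- After M, the summands pay for the drift f, the potential λ and the source F₀, in this order.
  have h5 : (M + Λ ^ 2 / (2 * (1 - θ) * μ.δ) + 2 * Λ + ε⁻¹) * u p ^ 2 ≤ 2 * K * u p ^ 2 := by
    unfold weightThreshold at hK
    gcongr
    linarith
  rw [e1, e2]
  nlinarith

theorem cylMeasure_eq : μ.cylMeasure =
    ((volume : Measure (Rn μ.n)).restrict μ.D).prod
      ((volume : Measure ℝ).restrict (Ioo 0 μ.T)) := by
  rw [Measure.prod_restrict]; rfl

theorem intervalIntegrable_slice {φ : Rn μ.n × ℝ → ℝ} (hφ : Integrable φ μ.cylMeasure) {t : ℝ}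
    (ht : t ∈ Ioo 0 μ.T) : IntervalIntegrable (fun s => ∫ x in μ.D, φ (x, s)) volume 0 t := by
  rw [cylMeasure_eq] at hφ
  rw [intervalIntegrable_iff_integrableOn_Ioc_of_le ht.1.le]
  exact IntegrableOn.mono_set hφ.integral_prod_right
    fun s hs => ⟨hs.1, hs.2.trans_lt ht.2⟩

theorem ae_integrable_slice {φ : Rn μ.n × ℝ → ℝ} (hφ : Integrable φ μ.cylMeasure) :
    ∀ᵐ s, s ∈ Ioo 0 μ.T → Integrable (fun x => φ (x, s)) (volume.restrict μ.D) := by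
  rw [cylMeasure_eq] at hφ
  exact (ae_restrict_iff' measurableSet_Ioo).1 hφ.prod_left_ae

theorem ae_ae_slice {P : Rn μ.n × ℝ → Prop} (hP : ∀ᵐ p ∂μ.cylMeasure, P p) :
    ∀ᵐ s, s ∈ Ioo 0 μ.T → ∀ᵐ x ∂(volume.restrict μ.D), P (x, s) := by
  rw [cylMeasure_eq] at hP
  refine (ae_restrict_iff' measurableSet_Ioo).1 ?_
  exact Measure.ae_ae_of_ae_prod (Measure.measurePreserving_swap.quasiMeasurePreserving.ae hP)

end Parameters

/-! ### Integrated estimate and best constants -/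

/-- The energy estimate for a single problem. -/
theorem IsSolution.energy_estimate {μ : Parameters} {F : Rn μ.n × ℝ → Rn μ.n}
    {F₀ u : Rn μ.n × ℝ → ℝ} (hF : MemLp F 2 μ.cylMeasure) (hF₀ : MemLp F₀ 2 μ.cylMeasure)
    (hu : IsSolution μ F F₀ u) {M ε K : ℝ} (hε : 0 < ε)
    (hK : weightThreshold M ε μ.δ μ.reduced.bound.toReal ≤ K) {t : ℝ} (ht : t ∈ Ioo 0 μ.T) :
    Real.exp (-2 * K * t) * (∫ x in μ.D, u (x, t) ^ 2)
        + M * ∫ s in (0 : ℝ)..t, Real.exp (-2 * K * s) * ∫ x in μ.D, u (x, s) ^ 2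
      ≤ (1 / 2 + ε) * (∫ s in (0 : ℝ)..t, Real.exp (-2 * K * s) *
            ∫ x in μ.D, (F (x, s)).ofLp ⬝ᵥ ((μ.b (x, s))⁻¹ *ᵥ (F (x, s)).ofLp))
        + ε * ∫ s in (0 : ℝ)..t, Real.exp (-2 * K * s) * ∫ x in μ.D, F₀ (x, s) ^ 2 := by
  obtain ⟨G, hX, hE⟩ := hu.energy_identity hF hF₀
  have iH : Integrable (fun p => 2 * ⟪μ.flux F F₀ u G p, μ.state u G p⟫) μ.cylMeasure :=
    ((integrable_inner_of_memLp (μ.memLp_flux hF hF₀ hX.memLp hX.memLp_grad)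
      (μ.memLp_state hX.memLp hX.memLp_grad)).restrict).const_mul 2
  have iu : Integrable (fun p => u p ^ 2) μ.cylMeasure := hX.memLp.integrable_sq
  have iF := μ.integrable_inv_form hF
  have iF₀ : Integrable (fun p => F₀ p ^ 2) μ.cylMeasure := hF₀.integrable_sq
  have jH := μ.intervalIntegrable_slice iH ht
  have hE' : ∀ s ∈ Ioo 0 μ.T, ∫ x in μ.D, u (x, s) ^ 2 =
      ∫ r in (0 : ℝ)..s, ∫ x in μ.D, 2 * ⟪μ.flux F F₀ u G (x, r), μ.state u G (x, r)⟫ := by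
    intro s hs
    simp only [integral_const_mul, intervalIntegral.integral_const_mul]
    exact hE s hs
  have hexp : ∀ {φ : ℝ → ℝ}, IntervalIntegrable φ volume 0 t →
      IntervalIntegrable (fun s => Real.exp (-2 * K * s) * φ s) volume 0 t := fun h =>
    h.continuousOn_mul (Continuous.continuousOn (by fun_prop))
  have ju := hexp (μ.intervalIntegrable_slice iu ht)
  have jF := hexp (μ.intervalIntegrable_slice iF ht)
  have jF₀ := hexp (μ.intervalIntegrable_slice iF₀ ht)
  have jP : IntervalIntegrable (fun s => Real.exp (-2 * K * s) *
      ((∫ x in μ.D, 2 * ⟪μ.flux F F₀ u G (x, s), μ.state u G (x, s)⟫) + -2 * K *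
        ∫ r in (0 : ℝ)..s, ∫ x in μ.D, 2 * ⟪μ.flux F F₀ u G (x, r), μ.state u G (x, r)⟫))
      volume 0 t :=
    hexp (jH.add ((jH.absolutelyContinuousOnInterval_intervalIntegral
      left_mem_uIcc).continuousOn.intervalIntegrable.const_mul _))
  have hparts := exp_mul_integral_eq jH (-2 * K)
  rw [← hE' t ht] at hparts
  rw [hparts, ← intervalIntegral.integral_const_mul, ← intervalIntegral.integral_const_mul,
    ← intervalIntegral.integral_const_mul, ← intervalIntegral.integral_add (jF.const_mul _)
    (jF₀.const_mul _), ← intervalIntegral.integral_add jP (ju.const_mul _)]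
  refine intervalIntegral.integral_mono_ae_restrict ht.1.le (jP.add (ju.const_mul _))
    ((jF.const_mul _).add (jF₀.const_mul _)) ?_
  refine (ae_restrict_iff' measurableSet_Icc).2 ?_
  filter_upwards [Measure.ae_ne volume (0 : ℝ), μ.ae_integrable_slice iH, μ.ae_integrable_slice iu,
    μ.ae_integrable_slice iF, μ.ae_integrable_slice iF₀,
    μ.ae_ae_slice (μ.ae_two_inner_flux_le (F := F) (F₀ := F₀) (u := u) (G := G) hε hK)]
    with s h0 kH ku kF kF₀ kle hs
  have hs' : s ∈ Ioo 0 μ.T := ⟨lt_of_le_of_ne hs.1 h0.symm, hs.2.trans_lt ht.2⟩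
  have k1 := (ku hs').const_mul (2 * K - M)
  have k2 := (kF hs').const_mul (1 / 2 + ε)
  have k3 := (kF₀ hs').const_mul ε
  have k12 : Integrable (fun x => (2 * K - M) * u (x, s) ^ 2 +
      (1 / 2 + ε) * ((F (x, s)).ofLp ⬝ᵥ ((μ.b (x, s))⁻¹ *ᵥ (F (x, s)).ofLp)))
      (volume.restrict μ.D) := k1.add k2
  have hle := integral_mono_ae (kH hs') (k12.add k3) (kle hs')
  simp only [Pi.add_apply] at hle
  rw [integral_add k12 k3, integral_add k1 k2, integral_const_mul (2 * K - M),
    integral_const_mul (1 / 2 + ε), integral_const_mul ε] at hle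
  rw [← hE' s hs']
  have hmul := mul_le_mul_of_nonneg_left hle (Real.exp_pos (-2 * K * s)).le
  linarith

/-- The energy estimate holds with constants `1 / 2 + ε` and `ε` for all large weights. -/
theorem energyEstimate_of_weightThreshold_le (μ : Parameters) {M ε K : ℝ} (hε : 0 < ε)
    (hK : weightThreshold M ε μ.δ μ.reduced.bound.toReal ≤ K) :
    EnergyEstimate K M μ.reduced (1 / 2 + ε) ε := by
  refine ⟨by linarith, hε, fun ν hν F F₀ u hF hF₀ hu t ht => ?_⟩
  -- The threshold sees a problem only through δ and the coefficient bound, so one K serves all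
  -- problems with the same reduced parameters.
  have hδ : ν.δ = μ.δ := congrArg ReducedParameters.δ hν
  exact hu.energy_estimate hF hF₀ hε (by rwa [hδ, hν]) ht

/-- If all estimates with arbitrarily small `ε` are available, the best constant is at most the
limit of the constants. -/
theorem supInf_le_of_forall {C : ℝ → ℝ → ReducedParameters → ℝ≥0∞} {a : ℝ}
    (h : ∀ (μ : Parameters) (M ε : ℝ), 0 ≤ M → 0 < ε →
      ∃ K : ℝ, 0 ≤ K ∧ C K M μ.reduced ≤ ENNReal.ofReal (a + ε)) :
    supInf C ≤ ENNReal.ofReal a := by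
  refine iSup_le fun μ => iSup_le fun M => iSup_le fun hM => ?_
  refine ENNReal.le_of_forall_pos_le_add fun ε hε _ => ?_
  obtain ⟨K, hK, hle⟩ := h μ M ε hM (by exact_mod_cast hε)
  refine (iInf₂_le K hK).trans (hle.trans ?_)
  exact ENNReal.ofReal_add_le.trans_eq (by rw [ENNReal.ofReal_coe_nnreal])

end Parabolic

open Parabolic in
theorem theorem1 :
    supInf C₁ ≤ 1 / 2 ∧
    supInf C₀ = 0 ∧
    (∀ (μ : Parameters) (M ε : ℝ), 0 ≤ M → 0 < ε →
      ∃ K₀ : ℝ, 0 ≤ K₀ ∧ ∀ K : ℝ, K₀ ≤ K → EnergyEstimate K M μ.reduced (1 / 2 + ε) ε) := by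
  have main : ∀ (μ : Parameters) (M ε : ℝ), 0 ≤ M → 0 < ε →
      ∃ K₀ : ℝ, 0 ≤ K₀ ∧ ∀ K : ℝ, K₀ ≤ K → EnergyEstimate K M μ.reduced (1 / 2 + ε) ε :=
    fun μ M ε hM hε => ⟨weightThreshold M ε μ.δ μ.reduced.bound.toReal,
      weightThreshold_nonneg hM hε μ.δ_pos ENNReal.toReal_nonneg,
      fun K hK => energyEstimate_of_weightThreshold_le μ hε hK⟩
  refine ⟨?_, ?_, main⟩
  · have h := supInf_le_of_forall (C := C₁) (a := 1 / 2) fun μ M ε hM hε => by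
      obtain ⟨K, hK0, hK⟩ := main μ M ε hM hε
      exact ⟨K, hK0, iInf_le_of_le _ (iInf_le_of_le _ (iInf_le_of_le (hK K le_rfl) le_rfl))⟩
    refine h.trans_eq ?_
    rw [ENNReal.ofReal_div_of_pos two_pos]
    simp
  · have h := supInf_le_of_forall (C := C₀) (a := 0) fun μ M ε hM hε => by
      obtain ⟨K, hK0, hK⟩ := main μ M ε hM hε
      refine ⟨K, hK0, iInf_le_of_le _ (iInf_le_of_le _ (iInf_le_of_le (hK K le_rfl) ?_))⟩
      rw [zero_add]
    simpa using h
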